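/- Let $\mathcal H$ be a real Hilbert space and let $V$ be a closed vector subspace of $\mathcal H$, with normal cone operator $N_V$ ($N_Vx=V^\perp$ if $x\in V$, $N_Vx=\varnothing$ otherwise) and with $P_V$, $P_{V^\perp}$ the orthogonal projections onto $V$ and $V^\perp$. Let $A\colon\mathcal H\to 2^{\mathcal H}$ be maximally monotone, let $B\colon\mathcal H\to\mathcal H$ be monotone and $L$-Lipschitzian for some $L\in\,]0,+\infty[$, and let $C\colon\mathcal H\to\mathcal H$ be $\beta$-cocoercive for some $\beta\in\,]0,+\infty[$, i.e. $\langle x-y\mid Cx-Cy\rangle\ge\beta\|Cx-Cy\|^2$ for all $x,y\in\mathcal H$. Suppose that the set $Z=\{x\in\mathcal H : 0\in Ax+Bx+Cx+N_Vx\}$ is nonempty. Set $$\chi=\frac{4\beta}{1+\sqrt{1+16\beta^2L^2}}.$$ Then $\chi\in\,]0,\min\{2\beta,1/L\}[$. Moreover, let $\gamma\in\,]0,+\infty[$, let $\varepsilon\in\,]0,\chi/(2\gamma)[$, let $(\lambda_n)_{n\in\mathbb N}$ be a sequence in $[\varepsilon,\chi/\gamma-\varepsilon]$, let $(x_0,y_0)\in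 V\times V^\perp$, and let $(x_n)_{n\in\mathbb N}$ and $(y_n)_{n\in\mathbb N}$ be sequences in $\mathcal H$ such that, for every $n\in\mathbb N$, there is $(p_n,q_n)\in\mathcal H^2$ with $$x_n+\gamma y_n-\lambda_n\gamma P_V(B+C)x_n=p_n+\gamma q_n,\qquad \frac{P_Vq_n}{\lambda_n}+P_{V^\perp}q_n\in A\Big(P_Vp_n+\frac{P_{V^\perp}p_n}{\lambda_n}\Big),$$ $$x_{n+1}=P_Vp_n+\lambda_n\gamma P_V(Bx_n-BP_Vp_n),\qquad y_{n+1}=P_{V^\perp}q_n.$$ Then $x_n\in V$ and $y_n\in V^\perp$ for every $n\in\mathbb N$, and there exist $\overline x\in Z$ and $\overline y\in V^\perp\cap(A\overline x+P_V(B+C)\overline x)$ such that $x_n\rightharpoonup\overline x$ and $y_n\rightharpoonup\overline y$ weakly in $\mathcal H$. -/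

import Mathlib

open Filter Topology
open scoped NNReal Pointwise RealInnerProductSpace

noncomputable section

namespace PartialInverseSplitting

variable {H : Type*} [NormedAddCommGroup H] [InnerProductSpace ℝ H]

/-- A set-valued operator on `H`, given by its values `A x ⊆ H`, is monotone. -/
def IsMonotoneOperator (A : H → Set H) : Prop :=
  ∀ ⦃x u y v : H⦄, u ∈ A x → v ∈ A y → 0 ≤ ⟪x - y, u - v⟫

/-- A set-valued operator is maximally monotone: its graph consists exactly of the points that are
monotonically related to every point of the graph. The implication from left to right is
monotonicity, the one from right to left is maximality. -/
def IsMaximallyMonotone (A : H → Set H) : Prop :=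
  ∀ x u : H, u ∈ A x ↔ ∀ y v : H, v ∈ A y → 0 ≤ ⟪x - y, u - v⟫

/-- A single-valued operator `T : H → H` is `β`-cocoercive. -/
def IsCocoercive (β : ℝ) (T : H → H) : Prop :=
  ∀ x y : H, β * ‖T x - T y‖ ^ 2 ≤ ⟪x - y, T x - T y⟫

/-- The normal cone operator of a set `S` (the subdifferential of its indicator function): it is
empty outside `S`. -/
def normalCone (S : Set H) (x : H) : Set H :=
  {u | x ∈ S ∧ ∀ y ∈ S, ⟪y - x, u⟫ ≤ 0}

/-- The set of solutions `x` of the inclusion `0 ∈ A x + B x + C x + N_V x`; sums of sets are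
Minkowski sums. -/
def solutionSet (V : ClosedSubmodule ℝ H) (A : H → Set H) (B C : H → H) : Set H :=
  {x | (0 : H) ∈ A x + {B x} + {C x} + normalCone (V : Set H) x}

/-- The constant `χ = 4β / (1 + √(1 + 16 β² L²))`. -/
def chi (β L : ℝ) : ℝ :=
  4 * β / (1 + √(1 + 16 * β ^ 2 * L ^ 2))

/-- The orthogonal projection of `H` onto the closed subspace `V`. -/
def proj [CompleteSpace H] (V : ClosedSubmodule ℝ H) : H →L[ℝ] H :=
  V.toSubmodule.starProjection

/-- One iteration of the algorithm, with parameters `γ` and `lam`, leads from the pair `(x, y)` to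
the pair `(x', y')`. -/
def IsStep [CompleteSpace H] (V : ClosedSubmodule ℝ H) (A : H → Set H) (B C : H → H)
    (γ lam : ℝ) (x y x' y' : H) : Prop :=
  ∃ p q : H,
    x + γ • y - (lam * γ) • proj V ((B + C) x) = p + γ • q ∧
    lam⁻¹ • proj V q + proj Vᗮ q ∈ A (proj V p + lam⁻¹ • proj Vᗮ p) ∧
    x' = proj V p + (lam * γ) • proj V (B x - B (proj V p)) ∧
    y' = proj Vᗮ q

/-- Weak convergence of a sequence in `H`. -/
def WeaklyConverges (x : ℕ → H) (a : H) : Prop :=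
  Tendsto (fun n => toWeakSpace ℝ H (x n)) atTop (𝓝 (toWeakSpace ℝ H a))

end PartialInverseSplitting

end

namespace PartialInverseSplitting

variable {H : Type*} [NormedAddCommGroup H] [InnerProductSpace ℝ H]

/-! Put `r n = x n + γ • y n`. The algorithm is then the forward-backward-half-forward iteration for
the partial inverse of `γA` with respect to `V`, perturbed by `γ P_V B P_V` and `γ P_V C P_V`
(`IsStep.exists_halfForward`). A zero `z` of this sum encodes a primal solution `P_V z` and a dual
one `γ⁻¹ (z - P_V z)`.

The iteration decreases the squared distance to each zero by a multiple of `‖r n - s n‖ ^ 2`, `s n`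
being the resolvent point; `χ` is the step size at which this multiple vanishes. Hence `r n - s n →
0`, `neg_mem_of_tendsto` shows that weak cluster points are zeros, and Opial's argument gives weak
convergence of `r`. Projecting onto `V` and `Vᗮ` separates the two limits. -/

theorem IsMaximallyMonotone.isMonotoneOperator {A : H → Set H} (hA : IsMaximallyMonotone A) :
    IsMonotoneOperator A :=
  fun _ _ _ _ hu hv => (hA _ _).1 hu _ _ hv

theorem isMonotoneOperator_singleton_iff {T : H → H} :
    IsMonotoneOperator (fun x => {T x}) ↔ ∀ x y, 0 ≤ ⟪x - y, T x - T y⟫ :=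
  ⟨fun h _ _ => h rfl rfl, by rintro h x _ y _ rfl rfl; exact h x y⟩

theorem IsCocoercive.norm_sub_le {β : ℝ} (hβ : 0 < β) {C : H → H} (hC : IsCocoercive β C)
    (x y : H) : ‖C x - C y‖ ≤ β⁻¹ * ‖x - y‖ := by
  rw [inv_mul_eq_div, le_div_iff₀ hβ]
  rcases (norm_nonneg (C x - C y)).eq_or_lt with h | h
  · rw [← h]; simp
  · have := (hC x y).trans (real_inner_le_norm _ _)
    nlinarith

/-! ### Weak limits and closedness of graphs -/

/-- Bounded families in a Hilbert space converge weakly along ultrafilters. -/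
theorem exists_weak_limit_of_ultrafilter [CompleteSpace H] {ι : Type*} (U : Ultrafilter ι)
    {r : ι → H} {M : ℝ} (hr : ∀ i, ‖r i‖ ≤ M) :
    ∃ z : H, ∀ w, Tendsto (fun i => ⟪r i, w⟫) U (𝓝 ⟪z, w⟫) := by
  let f : ι → WeakDual ℝ H := fun i => StrongDual.toWeakDual (InnerProductSpace.toDual ℝ H (r i))
  have hK := WeakDual.isCompact_closedBall (𝕜 := ℝ) (E := H) 0 M
  obtain ⟨φ, -, hφ⟩ := hK.ultrafilter_le_nhds (U.map f) (by
    rw [le_principal_iff]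
    refine Filter.Eventually.of_forall (f := (U : Filter ι)) fun i => ?_
    simpa [f] using hr i)
  refine ⟨(InnerProductSpace.toDual ℝ H).symm (WeakDual.toStrongDual φ), fun w => ?_⟩
  have h : Tendsto (fun i => f i w) U (𝓝 (φ w)) :=
    ((WeakDual.eval_continuous w).tendsto φ).comp hφ
  rw [InnerProductSpace.toDual_symm_apply]
  exact h

/-- A point monotonically related to the graph of a continuous single-valued operator lies on it. -/
theorem eq_of_forall_inner_nonneg {T : H → H} (hT : Continuous T) {x u : H}
    (h : ∀ y, 0 ≤ ⟪x - y, u - T y⟫) : u = T x := by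
  -- Minty's trick: test at `x - t • d`, divide by `t` and let `t` decrease to `0`; this yields
  -- `-‖d‖ ^ 2 ≥ 0`.
  set d := T x - u
  have hlim : Tendsto (fun t : ℝ => ⟪d, u - T (x - t • d)⟫) (𝓝[>] 0) (𝓝 ⟪d, u - T x⟫) := by
    have : Continuous fun t : ℝ => ⟪d, u - T (x - t • d)⟫ := by fun_prop
    simpa using (this.tendsto 0).mono_left nhdsWithin_le_nhds
  have h0 : 0 ≤ ⟪d, u - T x⟫ := by
    refine ge_of_tendsto hlim ?_
    filter_upwards [self_mem_nhdsWithin] with t ht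
    have := h (x - t • d)
    rw [sub_sub_cancel, real_inner_smul_left] at this
    exact nonneg_of_mul_nonneg_right this ht
  have hd : d = 0 := by
    rw [← neg_sub, inner_neg_right, real_inner_self_eq_norm_sq] at h0
    have : ‖d‖ = 0 := by nlinarith [norm_nonneg d]
    exact norm_eq_zero.1 this
  exact (sub_eq_zero.1 hd).symm

/-- The graph of the sum of a maximally monotone operator and a continuous monotone operator is
closed for the weak topology in the first variable and the norm topology in the second one. -/
theorem neg_mem_of_tendsto {ι : Type*} {F : Filter ι} [F.NeBot] {A : H → Set H}
    (hA : IsMaximallyMonotone A) {T : H → H} (hT : Continuous T)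
    (hTm : ∀ x y, 0 ≤ ⟪x - y, T x - T y⟫) {s v : ι → H} {M : ℝ} {a b : H}
    (hmem : ∀ i, v i ∈ A (s i)) (hM : ∀ i, ‖s i‖ ≤ M)
    (hs : ∀ w, Tendsto (fun i => ⟪s i, w⟫) F (𝓝 ⟪a, w⟫))
    (hv : ∀ w, Tendsto (fun i => ⟪v i, w⟫) F (𝓝 ⟪b, w⟫))
    (he : Tendsto (fun i => v i + T (s i)) F (𝓝 0)) :
    -T a ∈ A a := by
  have hse : Tendsto (fun i => ⟪v i + T (s i), s i - a⟫) F (𝓝 0) := by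
    refine squeeze_zero_norm (a := fun i => ‖v i + T (s i)‖ * (M + ‖a‖)) (fun i => ?_) ?_
    · refine (norm_inner_le_norm _ _).trans ?_
      gcongr
      exact (norm_sub_le _ _).trans (by gcongr; exact hM i)
    · simpa using he.norm.mul_const (M + ‖a‖)
  -- Only `⟪v i, s i⟫` is not weakly continuous. Monotonicity of `T` between `s i` and `a`, with
  -- `hse`, bounds its upper limit by `⟪b, a⟫`.
  have hb : b ∈ A a := by
    refine (hA a b).2 fun y w hw => ?_
    have hlim := ((((hse.sub ((hs (T a)).sub_const ⟪a, T a⟫)).add (hv a)).sub (hs w)).sub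
      (hv y)).add_const ⟪y, w⟫
    have hval : 0 - (⟪a, T a⟫ - ⟪a, T a⟫) + ⟪b, a⟫ - ⟪a, w⟫ - ⟪b, y⟫ + ⟪y, w⟫
        = ⟪a - y, b - w⟫ := by
      simp only [inner_sub_left, inner_sub_right, real_inner_comm b a, real_inner_comm b y]; ring
    rw [hval] at hlim
    refine ge_of_tendsto' hlim fun i => ?_
    have h1 := hA.isMonotoneOperator (hmem i) hw
    have h2 := hTm (s i) a
    simp only [inner_sub_left, inner_sub_right, inner_add_left] at h1 h2 ⊢
    simp only [real_inner_comm (s i) (v i), real_inner_comm a (v i), real_inner_comm y (v i),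
      real_inner_comm (s i) (T (s i)), real_inner_comm a (T (s i))] at h1 h2 ⊢
    linarith
  -- The roles are exchanged: `T (s i)` tends weakly to `-b`, and monotonicity of `A` between `s i`
  -- and `a`, available now that `b ∈ A a`, gives the opposite bound.
  have hbT : -b = T a := by
    refine eq_of_forall_inner_nonneg hT fun y => ?_
    have hea : Tendsto (fun i => ⟪v i + T (s i), a - y⟫) F (𝓝 0) := by
      simpa using he.inner (tendsto_const_nhds (x := a - y))
    have hlim := ((((hse.add hea).sub ((hs b).add ((hv a).sub_const ⟪a, b⟫))).add (hv y)).sub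
      ((hs (T y)).sub_const ⟪y, T y⟫))
    have hval : 0 + 0 - (⟪a, b⟫ + (⟪b, a⟫ - ⟪a, b⟫)) + ⟪b, y⟫ - (⟪a, T y⟫ - ⟪y, T y⟫)
        = ⟪a - y, -b - T y⟫ := by
      simp only [inner_sub_left, inner_sub_right, inner_neg_right, real_inner_comm b a,
        real_inner_comm b y]; ring
    rw [hval] at hlim
    refine ge_of_tendsto' hlim fun i => ?_
    have h1 := hA.isMonotoneOperator (hmem i) hb
    have h2 := hTm (s i) y
    simp only [inner_sub_left, inner_sub_right, inner_add_left] at h1 h2 ⊢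
    simp only [real_inner_comm (s i) (v i), real_inner_comm a (v i), real_inner_comm y (v i),
      real_inner_comm (s i) (T (s i)), real_inner_comm a (T (s i)),
      real_inner_comm y (T (s i))] at h1 h2 ⊢
    linarith
  rwa [← hbT, neg_neg]

/-! ### The step-size bound -/

section Parameters

variable {β L : ℝ}

theorem chi_pos (hβ : 0 < β) : 0 < chi β L := by
  unfold chi; positivity

theorem chi_lt_two_mul (hβ : 0 < β) (hL : 0 < L) : chi β L < 2 * β := by
  have h : 1 < √(1 + 16 * β ^ 2 * L ^ 2) := by
    rw [Real.lt_sqrt zero_le_one]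
    have : 0 < 16 * β ^ 2 * L ^ 2 := by positivity
    linarith
  rw [chi, div_lt_iff₀ (by linarith)]
  nlinarith

theorem chi_lt_inv (hβ : 0 < β) (hL : 0 < L) : chi β L < 1 / L := by
  have h : 4 * β * L ≤ √(1 + 16 * β ^ 2 * L ^ 2) := Real.le_sqrt_of_sq_le (by nlinarith)
  rw [chi, div_lt_div_iff₀ (by positivity) hL]
  linarith

/-- This quadratic equation, of which `χ` is the positive root, explains the formula for `χ`. -/
theorem sq_chi_mul_add (hβ : 0 < β) : chi β L ^ 2 * L ^ 2 + chi β L / (2 * β) = 1 := by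
  have hs : √(1 + 16 * β ^ 2 * L ^ 2) ^ 2 = 1 + 16 * β ^ 2 * L ^ 2 := Real.sq_sqrt (by positivity)
  have h0 : (1 + √(1 + 16 * β ^ 2 * L ^ 2)) ≠ 0 := by positivity
  unfold chi
  generalize √(1 + 16 * β ^ 2 * L ^ 2) = t at *
  field_simp
  linear_combination (-2 : ℝ) * hs

theorem chi_div_mul {γ : ℝ} (hγ : 0 < γ) : chi (β / γ) (γ * L) = chi β L / γ := by
  have : 16 * (β / γ) ^ 2 * (γ * L) ^ 2 = 16 * β ^ 2 * L ^ 2 := by field_simp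
  rw [chi, chi, this]
  ring

/-- The quadratic of `sq_chi_mul_add` increases on nonnegative reals; its linear term alone provides
the margin. -/
theorem le_one_sub_of_le_chi_sub (hβ : 0 < β) {ε l : ℝ} (hε : 0 ≤ ε) (hl : 0 ≤ l)
    (hl' : l ≤ chi β L - ε) : ε / (2 * β) ≤ 1 - l ^ 2 * L ^ 2 - l / (2 * β) := by
  have h1 : l / (2 * β) ≤ chi β L / (2 * β) - ε / (2 * β) := by
    rw [← sub_div]; gcongr
  have h2 : l ^ 2 * L ^ 2 ≤ chi β L ^ 2 * L ^ 2 := by gcongr; linarith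
  linarith [sq_chi_mul_add (L := L) hβ]

end Parameters

/-! ### The forward-backward-half-forward iteration -/

/-- One step of the forward-backward-half-forward iteration: `s` is the resolvent point. -/
theorem norm_halfForward_sub_sq_le {A : H → Set H} (hA : IsMonotoneOperator A) {B C : H → H}
    {L β l : ℝ} (hB : ∀ x y, 0 ≤ ⟪x - y, B x - B y⟫) (hBL : ∀ x y, ‖B x - B y‖ ≤ L * ‖x - y‖)
    (hβ : 0 < β) (hC : IsCocoercive β C) (hl : 0 < l) {r s z : H}
    (hs : l⁻¹ • (r - s) - B r - C r ∈ A s) (hz : -B z - C z ∈ A z) :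
    ‖s + l • (B r - B s) - z‖ ^ 2
      ≤ ‖r - z‖ ^ 2 - (1 - l ^ 2 * L ^ 2 - l / (2 * β)) * ‖r - s‖ ^ 2 := by
  have e1 : s + l • (B r - B s) - z = (s - z) + l • (B r - B s) := by abel
  have e2 : r - z = (s - z) + (r - s) := by abel
  have hn1 : ‖s + l • (B r - B s) - z‖ ^ 2
      = ‖s - z‖ ^ 2 + 2 * (l * ⟪s - z, B r - B s⟫) + l ^ 2 * ‖B r - B s‖ ^ 2 := by
    rw [e1, norm_add_sq_real, real_inner_smul_right, norm_smul, mul_pow, Real.norm_eq_abs, sq_abs]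
  have hn2 : ‖r - z‖ ^ 2 = ‖s - z‖ ^ 2 + 2 * ⟪s - z, r - s⟫ + ‖r - s‖ ^ 2 := by
    rw [e2, norm_add_sq_real]
  have hm : 0 ≤ ⟪s - z, r - s⟫ - l * ⟪s - z, B r - B s⟫ - l * ⟪s - z, B s - B z⟫
      - l * ⟪s - z, C r - C z⟫ := by
    have h := mul_nonneg hl.le (hA hs hz)
    have e : l⁻¹ • (r - s) - B r - C r - (-B z - C z)
        = l⁻¹ • (r - s) - (B r - B s) - (B s - B z) - (C r - C z) := by abel
    rw [e, inner_sub_right, inner_sub_right, inner_sub_right, real_inner_smul_right] at h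
    calc (0 : ℝ) ≤ _ := h
      _ = _ := by field_simp
  have hBsz := mul_nonneg hl.le (hB s z)
  have hcoc := mul_le_mul_of_nonneg_left (hC r z) hl.le
  have e3 : ⟪r - z, C r - C z⟫ = ⟪s - z, C r - C z⟫ + ⟪r - s, C r - C z⟫ := by
    rw [e2, inner_add_left]
  have hcs := mul_le_mul_of_nonneg_left (real_inner_le_norm (r - s) (C r - C z)) hl.le
  have hBsq : l ^ 2 * ‖B r - B s‖ ^ 2 ≤ l ^ 2 * (L * ‖r - s‖) ^ 2 := by
    gcongr; exact hBL r s
  -- Young's inequality, weighted so that the `C` term is exactly absorbed by cocoercivity.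
  have hyoung : 2 * (l * (‖r - s‖ * ‖C r - C z‖))
      ≤ 2 * (l * (β * ‖C r - C z‖ ^ 2)) + l / (2 * β) * ‖r - s‖ ^ 2 := by
    have h : 0 ≤ l / (2 * β) * (‖r - s‖ - 2 * β * ‖C r - C z‖) ^ 2 := by positivity
    have e : l / (2 * β) * (‖r - s‖ - 2 * β * ‖C r - C z‖) ^ 2
        = l / (2 * β) * ‖r - s‖ ^ 2 - 2 * (l * (‖r - s‖ * ‖C r - C z‖))
          + 2 * (l * (β * ‖C r - C z‖ ^ 2)) := by field_simp; ring
    linarith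
  rw [e3] at hcoc
  rw [hn1, hn2]
  nlinarith

/-- Opial's argument: if the distances to all weak limits along ultrafilters converge, then the
bounded sequence converges weakly. -/
theorem exists_weak_limit_of_opial [CompleteSpace H] {r : ℕ → H} {M : ℝ} (hM : ∀ n, ‖r n‖ ≤ M)
    {Z : Set H} (hZ : ∀ z ∈ Z, ∃ c, Tendsto (fun n => ‖r n - z‖ ^ 2) atTop (𝓝 c))
    (hlim : ∀ (U : Ultrafilter ℕ) (z : H), ↑U ≤ (atTop : Filter ℕ) →
      (∀ w, Tendsto (fun n => ⟪r n, w⟫) U (𝓝 ⟪z, w⟫)) → z ∈ Z) :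
    ∃ z ∈ Z, ∀ w, Tendsto (fun n => ⟪r n, w⟫) atTop (𝓝 ⟪z, w⟫) := by
  have huniq : ∀ z₁ ∈ Z, ∀ z₂ ∈ Z, ∀ U₁ U₂ : Ultrafilter ℕ, ↑U₁ ≤ (atTop : Filter ℕ) →
      ↑U₂ ≤ (atTop : Filter ℕ) → (∀ w, Tendsto (fun n => ⟪r n, w⟫) U₁ (𝓝 ⟪z₁, w⟫)) →
      (∀ w, Tendsto (fun n => ⟪r n, w⟫) U₂ (𝓝 ⟪z₂, w⟫)) → z₁ = z₂ := by
    intro z₁ h₁ z₂ h₂ U₁ U₂ hU₁ hU₂ hl₁ hl₂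
    obtain ⟨c₁, hc₁⟩ := hZ z₁ h₁
    obtain ⟨c₂, hc₂⟩ := hZ z₂ h₂
    -- The difference of the two squared distances is affine in `r n`, so this inner product
    -- converges along the whole sequence.
    have hc : Tendsto (fun n => ⟪r n, z₁ - z₂⟫) atTop
        (𝓝 ((c₂ - c₁ + ‖z₁‖ ^ 2 - ‖z₂‖ ^ 2) / 2)) := by
      refine ((((hc₂.sub hc₁).add_const (‖z₁‖ ^ 2)).sub_const (‖z₂‖ ^ 2)).div_const 2).congr
        fun n => ?_
      rw [norm_sub_sq_real, norm_sub_sq_real, inner_sub_right]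
      ring
    have e₁ := tendsto_nhds_unique (hl₁ (z₁ - z₂)) (hc.mono_left hU₁)
    have e₂ := tendsto_nhds_unique (hl₂ (z₁ - z₂)) (hc.mono_left hU₂)
    rw [← sub_eq_zero, ← inner_self_eq_zero (𝕜 := ℝ), inner_sub_left, e₁, e₂, sub_self]
  obtain ⟨z, hz⟩ := exists_weak_limit_of_ultrafilter (Ultrafilter.of atTop) hM
  have hzZ := hlim _ z (Ultrafilter.of_le _) hz
  refine ⟨z, hzZ, fun w => tendsto_iff_ultrafilter _ _ _ |>.2 fun U hU => ?_⟩
  obtain ⟨z', hz'⟩ := exists_weak_limit_of_ultrafilter U hM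
  rw [huniq z hzZ z' (hlim U z' hU hz') _ U (Ultrafilter.of_le _) hU hz hz']
  exact hz' w

/-- Weak convergence of the forward-backward-half-forward iteration to a zero of `A + B + C`. -/
theorem forwardBackwardHalfForward_weak_convergence [CompleteSpace H] {A : H → Set H}
    (hA : IsMaximallyMonotone A) {B C : H → H} {L β : ℝ}
    (hB : ∀ x y, 0 ≤ ⟪x - y, B x - B y⟫) (hL : 0 < L) (hBL : ∀ x y, ‖B x - B y‖ ≤ L * ‖x - y‖)
    (hβ : 0 < β) (hC : IsCocoercive β C) (hZ : ∃ z, -B z - C z ∈ A z)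
    {ε : ℝ} (hε : 0 < ε) {l : ℕ → ℝ} (hl : ∀ n, ε ≤ l n ∧ l n ≤ chi β L - ε) {r s : ℕ → H}
    (hs : ∀ n, (l n)⁻¹ • (r n - s n) - B (r n) - C (r n) ∈ A (s n))
    (hr : ∀ n, r (n + 1) = s n + l n • (B (r n) - B (s n))) :
    ∃ z, -B z - C z ∈ A z ∧ ∀ w, Tendsto (fun n => ⟪r n, w⟫) atTop (𝓝 ⟪z, w⟫) := by
  have hl0 n : 0 < l n := hε.trans_le (hl n).1
  set δ := ε / (2 * β)
  have hδ : 0 < δ := by positivity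
  have hstep : ∀ z, -B z - C z ∈ A z → ∀ n,
      ‖r (n + 1) - z‖ ^ 2 ≤ ‖r n - z‖ ^ 2 - δ * ‖r n - s n‖ ^ 2 := fun z hz n => by
    have h1 := norm_halfForward_sub_sq_le hA.isMonotoneOperator hB hBL hβ hC (hl0 n) (hs n) hz
    have h2 := mul_le_mul_of_nonneg_right
      (le_one_sub_of_le_chi_sub (L := L) hβ hε.le (hl0 n).le (hl n).2) (sq_nonneg ‖r n - s n‖)
    rw [hr n]
    linarith
  have hanti : ∀ z, -B z - C z ∈ A z → Antitone fun n => ‖r n - z‖ ^ 2 := fun z hz =>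
    antitone_nat_of_succ_le fun n => (hstep z hz n).trans (sub_le_self _ (by positivity))
  have hconv : ∀ z, -B z - C z ∈ A z → ∃ c, Tendsto (fun n => ‖r n - z‖ ^ 2) atTop (𝓝 c) :=
    fun z hz => ⟨_, tendsto_atTop_ciInf (hanti z hz)
      ⟨0, by rintro _ ⟨n, rfl⟩; positivity⟩⟩
  obtain ⟨z₀, hz₀⟩ := hZ
  have hbd n : ‖r n - z₀‖ ≤ ‖r 0 - z₀‖ := by
    have := hanti z₀ hz₀ (Nat.zero_le n)
    exact (sq_le_sq₀ (norm_nonneg _) (norm_nonneg _)).1 this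
  have hrM n : ‖r n‖ ≤ ‖r 0 - z₀‖ + ‖z₀‖ := by
    have := norm_add_le (r n - z₀) z₀
    rw [sub_add_cancel] at this
    linarith [hbd n]
  have hrs : Tendsto (fun n => r n - s n) atTop (𝓝 0) := by
    obtain ⟨c, hc⟩ := hconv z₀ hz₀
    have h0 : Tendsto (fun n => δ⁻¹ * (‖r n - z₀‖ ^ 2 - ‖r (n + 1) - z₀‖ ^ 2)) atTop (𝓝 0) := by
      simpa using (hc.sub (hc.comp (tendsto_add_atTop_nat 1))).const_mul δ⁻¹
    have h1 : Tendsto (fun n => ‖r n - s n‖ ^ 2) atTop (𝓝 0) := by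
      refine squeeze_zero (fun n => by positivity) (fun n => ?_) h0
      rw [inv_mul_eq_div, le_div_iff₀ hδ]
      linarith [hstep z₀ hz₀ n]
    rw [tendsto_zero_iff_norm_tendsto_zero]
    simpa using h1.sqrt
  have hCL := hC.norm_sub_le hβ
  have hBc : Continuous B := (LipschitzWith.of_dist_le' (K := L) fun x y => by
    simpa [dist_eq_norm] using hBL x y).continuous
  have hCc : Continuous C := (LipschitzWith.of_dist_le' (K := β⁻¹) fun x y => by
    simpa [dist_eq_norm] using hCL x y).continuous
  have hCm x y : 0 ≤ ⟪x - y, C x - C y⟫ := le_trans (by positivity) (hC x y)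
  set v : ℕ → H := fun n => (l n)⁻¹ • (r n - s n) - B (r n) - C (r n)
  have hnorm : Tendsto (fun n => ‖r n - s n‖) atTop (𝓝 0) := by simpa using hrs.norm
  -- Strong convergence uses the Lipschitz bounds and `l n ≥ ε`, which keeps the inverse step sizes
  -- bounded.
  have he : Tendsto (fun n => v n + (B (s n) + C (s n))) atTop (𝓝 0) := by
    refine squeeze_zero_norm (a := fun n => (ε⁻¹ + L + β⁻¹) * ‖r n - s n‖) (fun n => ?_) ?_
    · have e : v n + (B (s n) + C (s n))
          = (l n)⁻¹ • (r n - s n) - (B (r n) - B (s n)) - (C (r n) - C (s n)) := by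
        simp only [v]; abel
      have h1 : ‖(l n)⁻¹ • (r n - s n)‖ ≤ ε⁻¹ * ‖r n - s n‖ := by
        rw [norm_smul, Real.norm_of_nonneg (inv_nonneg.2 (hl0 n).le)]
        gcongr
        exact (hl n).1
      rw [e, add_mul, add_mul]
      exact (norm_sub_le _ _).trans (add_le_add ((norm_sub_le _ _).trans
        (add_le_add h1 (hBL _ _))) (hCL _ _))
    · simpa using hnorm.const_mul (ε⁻¹ + L + β⁻¹)
  obtain ⟨D, hD⟩ := hnorm.bddAbove_range
  obtain ⟨E, hE⟩ := he.norm.bddAbove_range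
  have hD' n : ‖r n - s n‖ ≤ D := hD ⟨n, rfl⟩
  have hE' n : ‖v n + (B (s n) + C (s n))‖ ≤ E := hE ⟨n, rfl⟩
  have hsM n : ‖s n‖ ≤ ‖r 0 - z₀‖ + ‖z₀‖ + D := by
    have := norm_sub_le (r n) (r n - s n)
    rw [sub_sub_cancel] at this
    linarith [hrM n, hD' n]
  have hvM n : ‖v n‖ ≤ E + ((L * (‖r 0 - z₀‖ + ‖z₀‖ + D) + ‖B 0‖)
      + (β⁻¹ * (‖r 0 - z₀‖ + ‖z₀‖ + D) + ‖C 0‖)) := by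
    have h1 : ‖B (s n)‖ ≤ L * (‖r 0 - z₀‖ + ‖z₀‖ + D) + ‖B 0‖ := by
      have h := norm_add_le (B (s n) - B 0) (B 0)
      rw [sub_add_cancel] at h
      have h' := (hBL (s n) 0).trans (mul_le_mul_of_nonneg_left (by simpa using hsM n) hL.le)
      linarith
    have h2 : ‖C (s n)‖ ≤ β⁻¹ * (‖r 0 - z₀‖ + ‖z₀‖ + D) + ‖C 0‖ := by
      have h := norm_add_le (C (s n) - C 0) (C 0)
      rw [sub_add_cancel] at h
      have h' := (hCL (s n) 0).trans
        (mul_le_mul_of_nonneg_left (by simpa using hsM n) (inv_nonneg.2 hβ.le))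
      linarith
    have h3 := norm_sub_le (v n + (B (s n) + C (s n))) (B (s n) + C (s n))
    rw [add_sub_cancel_right] at h3
    linarith [norm_add_le (B (s n)) (C (s n)), hE' n]
  refine exists_weak_limit_of_opial hrM (Z := {z | -B z - C z ∈ A z}) hconv
    fun U z hU hz => ?_
  have hsz : ∀ w, Tendsto (fun n => ⟪s n, w⟫) U (𝓝 ⟪z, w⟫) := fun w => by
    have h0 : Tendsto (fun n => ⟪r n - s n, w⟫) U (𝓝 0) := by
      simpa using (hrs.mono_left hU).inner (tendsto_const_nhds (x := w))
    simpa [inner_sub_left] using (hz w).sub h0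
  obtain ⟨b, hb⟩ := exists_weak_limit_of_ultrafilter U hvM
  have := neg_mem_of_tendsto (F := U) hA (T := fun x => B x + C x) (hBc.add hCc)
    (fun x y => by
      rw [add_sub_add_comm, inner_add_right]; exact add_nonneg (hB x y) (hCm x y))
    hs hsM hsz hb (he.mono_left hU)
  rwa [neg_add'] at this

/-! ### Scaling, partial inverses and the reformulation -/

/-- If `P` is additive, symmetric and nonexpansive and `C` is `β`-cocoercive, then `γ P C P` is
`β / γ`-cocoercive. -/
theorem IsCocoercive.smul_comp {β γ : ℝ} (hβ : 0 < β) (hγ : 0 < γ) {C : H → H}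
    (hC : IsCocoercive β C) {P : H → H} (hP : ∀ x y, ⟪x, P y⟫ = ⟪P x, y⟫)
    (hsub : ∀ x y, P (x - y) = P x - P y) (hle : ∀ x, ‖P x‖ ≤ ‖x‖) :
    IsCocoercive (β / γ) fun x => γ • P (C (P x)) := fun x y => by
  have h1 : ‖P (C (P x) - C (P y))‖ ^ 2 ≤ ‖C (P x) - C (P y)‖ ^ 2 := by gcongr; exact hle _
  have h2 : ⟪x - y, γ • P (C (P x)) - γ • P (C (P y))⟫ = γ * ⟪P x - P y, C (P x) - C (P y)⟫ := by
    rw [← smul_sub, ← hsub, real_inner_smul_right, hP, hsub x y]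
  rw [h2, ← smul_sub, ← hsub, norm_smul, mul_pow, Real.norm_eq_abs, sq_abs]
  calc β / γ * (γ ^ 2 * ‖P (C (P x) - C (P y))‖ ^ 2)
      = γ * (β * ‖P (C (P x) - C (P y))‖ ^ 2) := by field_simp
    _ ≤ γ * (β * ‖C (P x) - C (P y)‖ ^ 2) := by gcongr
    _ ≤ _ := by gcongr; exact hC _ _

theorem IsMaximallyMonotone.smul {A : H → Set H} (hA : IsMaximallyMonotone A) {γ : ℝ}
    (hγ : 0 < γ) : IsMaximallyMonotone fun x => {u | γ⁻¹ • u ∈ A x} := fun x u => by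
  rw [Set.mem_ofPred_eq, hA]
  constructor
  · intro h y v hv
    have := h y _ hv
    rw [← smul_sub, real_inner_smul_right] at this
    exact nonneg_of_mul_nonneg_right this (inv_pos.2 hγ)
  · intro h y v hv
    have := h y (γ • v) (by rwa [Set.mem_ofPred_eq, inv_smul_smul₀ hγ.ne'])
    have e : u - γ • v = γ • (γ⁻¹ • u - v) := by rw [smul_sub, smul_inv_smul₀ hγ.ne']
    rw [e, real_inner_smul_right] at this
    exact nonneg_of_mul_nonneg_right this hγ

theorem mem_normalCone_iff {V : ClosedSubmodule ℝ H} {x u : H} : u ∈ normalCone (V : Set H) x ↔ x ∈ V ∧ u ∈ Vᗮ := by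
  refine and_congr_right fun hx => ⟨fun h => ?_, fun h y hy => ?_⟩
  · rw [ClosedSubmodule.mem_orthogonal]
    intro y hy
    have h1 := h (x + y) (V.toSubmodule.add_mem hx hy)
    have h2 := h (x - y) (V.toSubmodule.sub_mem hx hy)
    rw [add_sub_cancel_left] at h1
    rw [sub_sub_cancel_left, inner_neg_left] at h2
    linarith
  · exact ((ClosedSubmodule.mem_orthogonal _ _).1 h _
      (V.toSubmodule.sub_mem hy hx)).le

section Projection

variable [CompleteSpace H] (V : ClosedSubmodule ℝ H)

theorem proj_orthogonal_apply (x : H) : proj Vᗮ x = x - proj V x :=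
  V.toSubmodule.starProjection_orthogonal_val x

theorem proj_proj (x : H) : proj V (proj V x) = proj V x :=
  Submodule.starProjection_eq_self_iff.2 (Submodule.starProjection_apply_mem _ _)

variable {V} in
theorem proj_eq_self_iff {x : H} : proj V x = x ↔ x ∈ V :=
  Submodule.starProjection_eq_self_iff

variable {V} in
theorem proj_eq_zero_iff {x : H} : proj V x = 0 ↔ x ∈ Vᗮ :=
  Submodule.starProjection_apply_eq_zero_iff _

theorem inner_proj_right (x y : H) : ⟪x, proj V y⟫ = ⟪proj V x, y⟫ :=
  (Submodule.inner_starProjection_left_eq_right _ _ _).symm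

theorem norm_proj_le (x : H) : ‖proj V x‖ ≤ ‖x‖ :=
  Submodule.norm_starProjection_apply_le _ _

/-- Spingarn's partial inverse of `A` with respect to `V`. -/
def partialInverse (A : H → Set H) (w : H) : Set H :=
  {v | proj V v + (w - proj V w) ∈ A (proj V w + (v - proj V v))}

/-- Exchanging the `Vᗮ` components of `w` and `v` preserves their pairing, since cross terms vanish.
-/
theorem inner_proj_swap (w v : H) :
    ⟪proj V w + (v - proj V v), proj V v + (w - proj V w)⟫ = ⟪w, v⟫ := by
  simp only [inner_add_left, inner_add_right, inner_sub_left, inner_sub_right, inner_proj_right,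
    proj_proj]
  rw [real_inner_comm w (proj V v), inner_proj_right, real_inner_comm w v]
  ring

/-- The exchange of `Vᗮ` components is a linear involution of `H × H` carrying one graph to the
other and preserving the pairing, hence being monotonically related. -/
theorem IsMaximallyMonotone.partialInverse {A : H → Set H} (hA : IsMaximallyMonotone A) :
    IsMaximallyMonotone (partialInverse V A) := fun w v => by
  have key : ∀ w v w' v' : H,
      ⟪proj V w + (v - proj V v) - (proj V w' + (v' - proj V v')),
        proj V v + (w - proj V w) - (proj V v' + (w' - proj V w'))⟫ = ⟪w - w', v - v'⟫ :=
    fun w v w' v' => by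
      rw [← inner_proj_swap V (w - w') (v - v'), map_sub, map_sub]
      congr 1 <;> abel
  rw [PartialInverseSplitting.partialInverse, Set.mem_ofPred_eq, hA]
  constructor
  · intro h w' v' hv'
    rw [← key]
    exact h _ _ hv'
  · intro h a u hu
    have e1 : proj V (proj V a + (u - proj V u)) = proj V a := by simp [proj_proj]
    have e2 : proj V (proj V u + (a - proj V a)) = proj V u := by simp [proj_proj]
    have ea : proj V a + (proj V u + (a - proj V a) - proj V u) = a := by abel
    have eu : proj V u + (proj V a + (u - proj V u) - proj V a) = u := by abel
    have := h (proj V a + (u - proj V u)) (proj V u + (a - proj V a)) (by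
      rw [PartialInverseSplitting.partialInverse, Set.mem_ofPred_eq, e1, e2, ea, eu]; exact hu)
    rwa [← key, e1, e2, ea, eu] at this

variable {V}

/-- `x` is a solution if and only if it lies in `V` and `A x` contains a vector whose projection
onto `V` is that of `-(B + C) x`. -/
theorem mem_solutionSet_iff {A : H → Set H} {B C : H → H} {x : H} :
    x ∈ solutionSet V A B C ↔ x ∈ V ∧ ∃ u ∈ A x, proj V u = -proj V ((B + C) x) := by
  have key (u : H) : -(u + B x + C x) ∈ Vᗮ ↔ proj V u = -proj V ((B + C) x) := by
    rw [← proj_eq_zero_iff, map_neg, neg_eq_zero, add_assoc, map_add, Pi.add_apply,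
      add_eq_zero_iff_eq_neg]
  constructor
  · rintro ⟨_, ⟨_, ⟨u, hu, _, rfl, rfl⟩, _, rfl, rfl⟩, n, hn, h0⟩
    obtain ⟨hx, hn⟩ := mem_normalCone_iff.1 hn
    refine ⟨hx, u, hu, (key u).1 ?_⟩
    rwa [← eq_neg_of_add_eq_zero_right h0]
  · rintro ⟨hx, u, hu, h⟩
    exact ⟨u + B x + C x, ⟨u + B x, ⟨u, hu, _, rfl, rfl⟩, _, rfl, rfl⟩, _,
      mem_normalCone_iff.2 ⟨hx, (key u).2 h⟩, add_neg_cancel _⟩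

/-- The zeros of the partial inverse of `γ A` perturbed by `γ P_V (B + C) P_V` encode primal and
dual solutions. -/
theorem zero_partialInverse_iff {A : H → Set H} {B C : H → H} {γ : ℝ} (hγ : 0 < γ) {z : H} :
    -(γ • proj V (B (proj V z))) - γ • proj V (C (proj V z))
        ∈ partialInverse V (fun x => {u | γ⁻¹ • u ∈ A x}) z ↔
      γ⁻¹ • (z - proj V z) - proj V ((B + C) (proj V z)) ∈ A (proj V z) := by
  have h1 : proj V (-(γ • proj V (B (proj V z))) - γ • proj V (C (proj V z)))
      = -(γ • proj V (B (proj V z))) - γ • proj V (C (proj V z)) := by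
    simp [proj_proj]
  rw [partialInverse, Set.mem_ofPred_eq, Set.mem_ofPred_eq, h1, sub_self, add_zero, Pi.add_apply,
    map_add]
  have : γ⁻¹ • (-(γ • proj V (B (proj V z))) - γ • proj V (C (proj V z)) + (z - proj V z))
      = γ⁻¹ • (z - proj V z) - (proj V (B (proj V z)) + proj V (C (proj V z))) := by
    rw [smul_add, smul_sub, smul_neg, inv_smul_smul₀ hγ.ne', inv_smul_smul₀ hγ.ne']; abel
  rw [this]

theorem exists_zero_partialInverse {A : H → Set H} {B C : H → H} {γ : ℝ} (hγ : 0 < γ)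
    (hZ : (solutionSet V A B C).Nonempty) :
    ∃ z, -(γ • proj V (B (proj V z))) - γ • proj V (C (proj V z))
        ∈ partialInverse V (fun x => {u | γ⁻¹ • u ∈ A x}) z := by
  obtain ⟨x, hx⟩ := hZ
  obtain ⟨hxV, u, hu, h⟩ := mem_solutionSet_iff.1 hx
  have hz : proj V (x + γ • (u - proj V u)) = x := by
    simp [proj_proj, proj_eq_self_iff.2 hxV]
  refine ⟨x + γ • (u - proj V u), (zero_partialInverse_iff hγ).2 ?_⟩
  rw [hz, add_sub_cancel_left, inv_smul_smul₀ hγ.ne', ← neg_eq_iff_eq_neg.2 h, sub_neg_eq_add,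
    sub_add_cancel]
  exact hu

theorem mem_of_zero_partialInverse {A : H → Set H} {B C : H → H} {γ : ℝ} (hγ : 0 < γ) {z : H}
    (hz : -(γ • proj V (B (proj V z))) - γ • proj V (C (proj V z))
        ∈ partialInverse V (fun x => {u | γ⁻¹ • u ∈ A x}) z) :
    proj V z ∈ solutionSet V A B C ∧ γ⁻¹ • (z - proj V z) ∈
      (Vᗮ : Set H) ∩ (A (proj V z) + {proj V ((B + C) (proj V z))}) := by
  rw [zero_partialInverse_iff hγ] at hz
  refine ⟨mem_solutionSet_iff.2 ⟨proj_eq_self_iff.1 (proj_proj V z), _, hz, by simp [proj_proj]⟩,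
    proj_eq_zero_iff.1 (by simp [proj_proj]), _, hz, _, rfl, sub_add_cancel _ _⟩

theorem IsStep.mem {A : H → Set H} {B C : H → H} {γ l : ℝ} {x y x' y' : H}
    (h : IsStep V A B C γ l x y x' y') : x' ∈ V ∧ y' ∈ Vᗮ := by
  obtain ⟨p, q, -, -, rfl, rfl⟩ := h
  exact ⟨proj_eq_self_iff.1 (by simp [proj_proj]), proj_eq_zero_iff.1 (by
    simp [proj_orthogonal_apply, proj_proj])⟩

/-- A step of the algorithm is a forward-backward-half-forward step for the partial inverse. -/
theorem IsStep.exists_halfForward {A : H → Set H} {B C : H → H} {γ l : ℝ} (hγ : 0 < γ)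
    (hl : 0 < l) {x y x' y' : H} (hx : x ∈ V) (hy : y ∈ Vᗮ)
    (h : IsStep V A B C γ l x y x' y') :
    ∃ s, l⁻¹ • (x + γ • y - s) - γ • proj V (B (proj V (x + γ • y)))
          - γ • proj V (C (proj V (x + γ • y)))
        ∈ partialInverse V (fun x => {u | γ⁻¹ • u ∈ A x}) s ∧
      x' + γ • y' = s + l • (γ • proj V (B (proj V (x + γ • y)))
        - γ • proj V (B (proj V s))) := by
  obtain ⟨p, q, heq, hmem, rfl, rfl⟩ := h
  have hx' := proj_eq_self_iff.2 hx
  have hy' := proj_eq_zero_iff.2 hy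
  have hr : proj V (x + γ • y) = x := by simp [hx', hy']
  -- The resolvent point is `P_V p + γ P_{Vᗮ} q`: the pair `(p, γ q)` with `Vᗮ` components
  -- exchanged, up to the factors `l⁻¹`.
  have hs : proj V (proj V p + γ • (q - proj V q)) = proj V p := by simp [proj_proj]
  have hPeq : x - (l * γ) • proj V ((B + C) x) = proj V p + γ • proj V q := by
    simpa [proj_proj, hx', hy'] using congrArg (proj V) heq
  have hQeq : γ • y = (p - proj V p) + γ • (q - proj V q) := by
    rw [smul_sub, ← add_sub_cancel_left (x - (l * γ) • proj V ((B + C) x)) (γ • y), sub_add_eq_add_sub,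
      heq, hPeq]
    abel
  have hv : l⁻¹ • (x + γ • y - (proj V p + γ • (q - proj V q))) - γ • proj V (B x)
      - γ • proj V (C x) = l⁻¹ • (γ • proj V q + (p - proj V p)) := by
    have e : x = proj V p + γ • proj V q + (l * γ) • proj V ((B + C) x) :=
      sub_eq_iff_eq_add.1 hPeq
    have e2 : x + γ • y - (proj V p + γ • (q - proj V q))
        = γ • proj V q + (p - proj V p) + l • (γ • proj V (B x) + γ • proj V (C x)) := by
      rw [hQeq, ← smul_add, ← map_add, smul_smul]
      nth_rewrite 1 [e]
      rw [Pi.add_apply]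
      abel
    rw [e2, smul_add l⁻¹, inv_smul_smul₀ hl.ne']
    abel
  have hPv : proj V (l⁻¹ • (γ • proj V q + (p - proj V p))) = l⁻¹ • γ • proj V q := by
    simp [proj_proj]
  refine ⟨proj V p + γ • (q - proj V q), ?_, ?_⟩
  · rw [hr, hv, partialInverse, Set.mem_ofPred_eq, Set.mem_ofPred_eq, hs, hPv]
    rw [proj_orthogonal_apply, proj_orthogonal_apply] at hmem
    convert hmem using 2
    · rw [smul_add, add_sub_cancel_left]
    · rw [add_sub_cancel_left, smul_add, smul_comm l⁻¹ γ, inv_smul_smul₀ hγ.ne',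
        inv_smul_smul₀ hγ.ne']
  · rw [hr, hs, proj_orthogonal_apply, map_sub, mul_smul, smul_sub γ]
    abel

end Projection

/-! ### Weak convergence of the two sequences -/

theorem weaklyConverges_of_forall_inner [CompleteSpace H] {x : ℕ → H} {a : H}
    (h : ∀ w, Tendsto (fun n => ⟪x n, w⟫) atTop (𝓝 ⟪a, w⟫)) : WeaklyConverges x a := by
  refine (WeakBilin.tendsto_iff_forall_eval_tendsto (topDualPairing ℝ H).flip ?_).2 fun f => ?_
  · exact fun x y h => ext_inner_left ℝ fun v =>
      DFunLike.congr_fun h (InnerProductSpace.toDual ℝ H v)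
  have e (y : H) : f y = ⟪y, (InnerProductSpace.toDual ℝ H).symm f⟫ := by
    rw [real_inner_comm, InnerProductSpace.toDual_symm_apply]
  change Tendsto (fun n => f (x n)) atTop (𝓝 (f a))
  simpa only [e] using h _

end PartialInverseSplitting

theorem theorem3p2 {H : Type*} [NormedAddCommGroup H] [InnerProductSpace ℝ H] [CompleteSpace H]
    (V : ClosedSubmodule ℝ H) (A : H → Set H) (B C : H → H) (L : ℝ≥0) (β : ℝ)
    (hA : PartialInverseSplitting.IsMaximallyMonotone A)
    (hBmono : PartialInverseSplitting.IsMonotoneOperator (fun x => {B x}))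
    (hL : 0 < L) (hBlip : LipschitzWith L B)
    (hβ : 0 < β) (hC : PartialInverseSplitting.IsCocoercive β C)
    (hZ : (PartialInverseSplitting.solutionSet V A B C).Nonempty) :
    (0 < PartialInverseSplitting.chi β L ∧
      PartialInverseSplitting.chi β L < min (2 * β) (1 / (L : ℝ))) ∧
    ∀ (γ : ℝ), 0 < γ →
    ∀ (ε : ℝ), 0 < ε → ε < PartialInverseSplitting.chi β L / (2 * γ) →
    ∀ (lam : ℕ → ℝ), (∀ n, ε ≤ lam n ∧ lam n ≤ PartialInverseSplitting.chi β L / γ - ε) →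
    ∀ (x y : ℕ → H), x 0 ∈ V → y 0 ∈ Vᗮ →
      (∀ n, PartialInverseSplitting.IsStep V A B C γ (lam n) (x n) (y n) (x (n + 1)) (y (n + 1))) →
      (∀ n, x n ∈ V) ∧ (∀ n, y n ∈ Vᗮ) ∧
      ∃ xbar ∈ PartialInverseSplitting.solutionSet V A B C,
      ∃ ybar ∈ (Vᗮ : Set H) ∩ (A xbar + {PartialInverseSplitting.proj V ((B + C) xbar)}),
        PartialInverseSplitting.WeaklyConverges x xbar ∧
        PartialInverseSplitting.WeaklyConverges y ybar := by
  open PartialInverseSplitting RealInnerProductSpace in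
  have hL' : (0 : ℝ) < L := hL
  refine ⟨⟨chi_pos hβ, lt_min (chi_lt_two_mul hβ hL') (chi_lt_inv hβ hL')⟩, ?_⟩
  intro γ hγ ε hε _ lam hlam x y hx0 hy0 hstep
  have hx : ∀ n, x n ∈ V
    | 0 => hx0
    | n + 1 => (hstep n).mem.1
  have hy : ∀ n, y n ∈ Vᗮ
    | 0 => hy0
    | n + 1 => (hstep n).mem.2
  refine ⟨hx, hy, ?_⟩
  choose s hs hr using fun n =>
    (hstep n).exists_halfForward hγ (hε.trans_le (hlam n).1) (hx n) (hy n)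
  have hBm := isMonotoneOperator_singleton_iff.1 hBmono
  -- The perturbations have Lipschitz constant `γ * L` and cocoercivity constant `β / γ`, so by
  -- `chi_div_mul` the step bound becomes `χ / γ`.
  obtain ⟨z, hz, hlim⟩ := forwardBackwardHalfForward_weak_convergence
    (A := partialInverse V fun x => {u | γ⁻¹ • u ∈ A x}) ((hA.smul hγ).partialInverse V)
    (B := fun x => γ • proj V (B (proj V x))) (C := fun x => γ • proj V (C (proj V x)))
    (L := γ * L) (β := β / γ)
    (fun x y => by
      rw [← smul_sub, ← map_sub, real_inner_smul_right, inner_proj_right, map_sub]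
      exact mul_nonneg hγ.le (hBm _ _))
    (mul_pos hγ hL')
    (fun x y => by
      rw [← smul_sub, ← map_sub, norm_smul, Real.norm_of_nonneg hγ.le, mul_assoc]
      gcongr
      refine (norm_proj_le V _).trans ((hBlip.norm_sub_le _ _).trans ?_)
      rw [← map_sub]
      gcongr
      exact norm_proj_le V _)
    (div_pos hβ hγ)
    (hC.smul_comp hβ hγ (inner_proj_right V) (map_sub _) (norm_proj_le V))
    (exists_zero_partialInverse hγ hZ) hε (l := lam)
    (by rwa [chi_div_mul hγ]) (r := fun n => x n + γ • y n) hs hr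
  obtain ⟨hxbar, hybar⟩ := mem_of_zero_partialInverse hγ hz
  have hxlim : ∀ w, Tendsto (fun n => ⟪x n, w⟫) atTop (𝓝 ⟪proj V z, w⟫) := fun w => by
    rw [← inner_proj_right]
    refine (hlim (proj V w)).congr fun n => ?_
    rw [inner_proj_right, map_add, map_smul, proj_eq_self_iff.2 (hx n),
      proj_eq_zero_iff.2 (hy n), smul_zero, add_zero]
  refine ⟨_, hxbar, _, hybar, weaklyConverges_of_forall_inner hxlim,
    weaklyConverges_of_forall_inner fun w => ?_⟩
  rw [real_inner_smul_left, inner_sub_left]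
  refine (((hlim w).sub (hxlim w)).const_mul γ⁻¹).congr fun n => ?_
  rw [inner_add_left, add_sub_cancel_left, real_inner_smul_left, inv_mul_cancel_left₀ hγ.ne']
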